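/- Call an abelian group indecomposable if it is not the direct sum of two non-trivial subgroups, and reduced if it has no non-trivial divisible subgroup; its rank is the size of a maximal $\mathbb{Z}$-linearly independent subset. A field extension $A/B$ is completely transcendental if every element of $A\setminus B$ is transcendental over $B$, and $A/B$ is purely transcendental if $A=B(S)$ for some set $S\subseteq A$ that is algebraically independent over $B$. A set $T$ is an essential union of a collection of subsets if $T$ is the union of the collection and no member of the collection can be omitted. Let $F$ be an infinite field whose multiplicative group $F^\times$ is indecomposable. Then $F$ has characteristic $2$, so that it is an extension of $\mathbf{F}_2$, and there is an intermediate field $F\supseteq L\supsetneq\mathbf{F}_2$ such that $L$ is a purely transcendental extension of $\mathbf{F}_2$ and $F$ is algebraic over $L$. Moreover, $F$ and every such $L$ satisfy the following. (1) The group $L^\times$ is free abelian of infinite rank. (2) $[F:L]=\infty$. (3) $F$ is a completely transcendental extension of $\mathbf{F}_2$. In particular, $F$ is not algebraically closed. (4) $F^\times$ is a torsion-free indecomposable abelian group of infinite rank. In particular, $F^\times$ is reduced and $\operatorname{Hom}(F^\times,\mathbb{Z})=0$. (5) $F^\times$ is an essential union of an infinite collection of subgroups, each of which has a direct summand that is a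 free abelian group isomorphic to $L^\times$. -/

import Mathlib

/-- An abelian group is (direct sum) indecomposable if it is not the internal direct product of
two nontrivial subgroups. -/
def IsIndecomposableGroup (G : Type*) [CommGroup G] : Prop :=
  ∀ H K : Subgroup G, IsCompl H K → H = ⊥ ∨ K = ⊥

/-- An abelian group is reduced if it has no nontrivial divisible subgroup. -/
def IsReducedGroup (G : Type*) [CommGroup G] : Prop :=
  ∀ D : Subgroup G, (∀ n : ℕ, n ≠ 0 → ∀ x ∈ D, ∃ y ∈ D, y ^ n = x) → D = ⊥

/-- The abelian group `G` has infinite rank: its maximal linearly independent subsets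
over `ℤ` are infinite. -/
def HasInfiniteRank (G : Type*) [CommGroup G] : Prop :=
  Cardinal.aleph0 ≤ Module.rank ℤ (Additive G)

/-- The abelian group `G` is free abelian. -/
def IsFreeAbelian (G : Type*) [CommGroup G] : Prop :=
  Module.Free ℤ (Additive G)

/-- The abelian group `G` has a direct summand isomorphic to `A`. -/
def HasSummandIsomorphicTo (G A : Type*) [CommGroup G] [CommGroup A] : Prop :=
  ∃ H K : Subgroup G, IsCompl H K ∧ Nonempty (H ≃* A)

/-- The set `T` is the union of the members of `C`, and no member of `C` can be left out. -/
def IsEssentialUnion {α : Type*} (T : Set α) (C : Set (Set α)) : Prop :=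
  ⋃₀ C = T ∧ ∀ S ∈ C, ⋃₀ (C \ {S}) ≠ T

/-- `E` is a purely transcendental extension of `k`: it is generated as a field over `k` by an
algebraically independent set. -/
def IsPurelyTranscendentalExtension (k E : Type*) [Field k] [Field E] [Algebra k E] : Prop :=
  ∃ s : Set E, AlgebraicIndependent k ((↑) : s → E) ∧ IntermediateField.adjoin k s = ⊤

/-- `E` is a completely transcendental extension of `k`: every element of `E` outside `k` is
transcendental over `k`. -/
def IsCompletelyTranscendentalExtension (k E : Type*) [Field k] [Field E] [Algebra k E] : Prop :=
  ∀ x : E, x ∉ Set.range (algebraMap k E) → Transcendental k x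

/-- `L` is strictly larger than `k`, purely transcendental over `k`, and `F` is algebraic
over `L`. -/
def IsProperPurelyTranscendentalBase {k F : Type*} [Field k] [Field F] [Algebra k F]
    (L : IntermediateField k F) : Prop :=
  L ≠ ⊥ ∧ IsPurelyTranscendentalExtension k L ∧ Algebra.IsAlgebraic L F

universe u

/-! An indecomposable group with an element of prime order `p` is a `p`-group
(`exists_pow_smul_eq_zero_of_indecomposable`). A field whose unit group is a `p`-group is finite,
because the orders of its finite subfields exceed powers of `p` by one, and such prime powers are
bounded. So `Fˣ` is torsion-free. Then `-1 = 1`, and an element algebraic over 𝔽₂ lies in a finite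
field, hence is 0 or 1.

The field `L` is the fraction field of a polynomial ring over 𝔽₂, a UFD whose only unit is 1, so
`Lˣ` is free on the infinitely many irreducibles. Hence `Fˣ` has infinite rank. An indecomposable
group with a nonzero homomorphism to ℤ, or a nonzero divisible subgroup, has rank at most one. Both
are therefore excluded, and a finite `[F : L]` would give such a homomorphism through the norm.

For the essential union, `rank Fˣ = |Fˣ|` leaves room to attach to each `g` a large free group
independent of `g` and of everything before it in a well-order (`exists_family_sup_pureHull`). A
greedy choice among these subgroups gives a cover in which each member has a private element. A
finite cover would contain a subgroup of finite index, which again yields a map to ℤ. -/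

/-! ### Direct summands of an indecomposable abelian group. -/

theorem IsIndecomposableGroup.eq_bot_of_isCompl {G : Type*} [CommGroup G]
    (h : IsIndecomposableGroup G) (P Q : Submodule ℤ (Additive G)) (hPQ : IsCompl P Q) :
    P = ⊥ ∨ Q = ⊥ := by
  let e : Submodule ℤ (Additive G) ≃o Subgroup G :=
    (Subgroup.toAddSubgroup.trans AddSubgroup.toIntSubmodule).symm
  exact (h (e P) (e Q) ((e.isCompl_iff).1 hPQ)).imp (fun h => (map_eq_bot_iff e).1 h)
    (fun h => (map_eq_bot_iff e).1 h)

/-- Divisible groups are injective by Baer's criterion, so the inclusion of `D` has a retraction,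
whose kernel is the complement. -/
theorem exists_isCompl_of_divisible {M : Type*} [AddCommGroup M] (D : Submodule ℤ M)
    (hD : ∀ n : ℕ, n ≠ 0 → ∀ x ∈ D, ∃ y ∈ D, n • y = x) : ∃ Q, IsCompl D Q := by
  have key : ∀ n : ℤ, n ≠ 0 → ∀ x : D, ∃ y : D, n • y = x := by
    rintro n hn ⟨x, hx⟩
    obtain ⟨y, hy, hyx⟩ := hD n.natAbs (by simpa using hn) x hx
    rw [← natCast_zsmul] at hyx
    rcases Int.natAbs_eq n with h | h
    · exact ⟨⟨y, hy⟩, Subtype.ext (by rw [h]; exact hyx)⟩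
    · refine ⟨-⟨y, hy⟩, Subtype.ext ?_⟩
      rw [h, neg_smul_neg]
      exact hyx
  classical
  let _ : DivisibleBy D ℤ :=
    { div := fun x n => if hn : n = 0 then 0 else (key n hn x).choose
      div_zero := fun x => by simp
      div_cancel := fun {n} x hn => by
        simpa only [dif_neg hn] using (key n hn x).choose_spec }
  obtain ⟨f, hf⟩ := (Module.Baer.of_divisible D).extension_property D.subtype
    D.subtype_injective LinearMap.id
  exact ⟨LinearMap.ker f, LinearMap.isCompl_of_proj fun x => LinearMap.congr_fun hf x⟩

theorem LinearMap.isCompl_ker_range_of_comp_eq_id {R M N : Type*} [Ring R] [AddCommGroup M]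
    [AddCommGroup N] [Module R M] [Module R N] {f : M →ₗ[R] N} {g : N →ₗ[R] M}
    (h : f ∘ₗ g = LinearMap.id) : IsCompl (LinearMap.ker f) (LinearMap.range g) := by
  have hfg (y) : f (g y) = y := LinearMap.congr_fun h y
  rw [isCompl_iff, Submodule.disjoint_def, Submodule.codisjoint_iff_exists_add_eq]
  refine ⟨?_, fun z => ⟨z - g (f z), g (f z), ?_, ⟨_, rfl⟩, sub_add_cancel _ _⟩⟩
  · rintro _ hx ⟨y, rfl⟩
    rw [LinearMap.mem_ker, hfg] at hx
    simp [hx]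
  · simp [hfg]

/-- The elements of `M` that have a nonzero integer multiple in `N`. -/
def Submodule.pureHull {M : Type*} [AddCommGroup M] (N : Submodule ℤ M) : Submodule ℤ M where
  carrier := {y | ∃ n : ℤ, n ≠ 0 ∧ n • y ∈ N}
  zero_mem' := ⟨1, one_ne_zero, by simp⟩
  add_mem' := by
    rintro a b ⟨m, hm, ha⟩ ⟨n, hn, hb⟩
    refine ⟨m * n, mul_ne_zero hm hn, ?_⟩
    rw [smul_add, mul_comm, mul_smul, mul_comm, mul_smul]
    exact N.add_mem (N.smul_mem _ ha) (N.smul_mem _ hb)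
  smul_mem' := by
    rintro c a ⟨m, hm, ha⟩
    exact ⟨m, hm, by rw [smul_comm]; exact N.smul_mem _ ha⟩

theorem Submodule.mem_pureHull {M : Type*} [AddCommGroup M] {N : Submodule ℤ M} {y : M} :
    y ∈ N.pureHull ↔ ∃ n : ℤ, n ≠ 0 ∧ n • y ∈ N := Iff.rfl

theorem Submodule.le_pureHull {M : Type*} [AddCommGroup M] (N : Submodule ℤ M) :
    N ≤ N.pureHull := fun y hy => ⟨1, one_ne_zero, by simpa using hy⟩

theorem rank_le_one_of_pureHull_eq_top {M : Type*} [AddCommGroup M] {x : M}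
    (h : (Submodule.span ℤ {x}).pureHull = ⊤) : Module.rank ℤ M ≤ 1 := by
  rw [← rank_quotient_add_rank_of_isDomain (Submodule.span ℤ {x}),
    rank_eq_zero_iff.2, zero_add]
  · exact (rank_span_le _).trans (by simp)
  · intro y
    obtain ⟨y, rfl⟩ := Submodule.Quotient.mk_surjective _ y
    obtain ⟨n, hn, hy⟩ := Submodule.mem_pureHull.1 (h ▸ Submodule.mem_top : y ∈ _)
    exact ⟨n, hn, by rwa [← Submodule.Quotient.mk_smul, Submodule.Quotient.mk_eq_zero]⟩

/-- The image of `f` is an ideal of ℤ, hence projective, so `ker f` is a direct summand. Either it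
vanishes and `M` embeds in ℤ, or `f = 0`. -/
theorem rank_le_one_of_linearMap_int_ne_zero {M : Type*} [AddCommGroup M]
    (hM : ∀ P Q : Submodule ℤ M, IsCompl P Q → P = ⊥ ∨ Q = ⊥) (f : M →ₗ[ℤ] ℤ) (hf : f ≠ 0) :
    Module.rank ℤ M ≤ 1 := by
  obtain ⟨g, hg⟩ := Module.projective_lifting_property f.rangeRestrict LinearMap.id
    f.surjective_rangeRestrict
  rcases hM _ _ (LinearMap.isCompl_ker_range_of_comp_eq_id hg) with h | h
  · rw [LinearMap.ker_rangeRestrict, LinearMap.ker_eq_bot] at h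
    simpa using LinearMap.lift_rank_le_of_injective f h
  · refine absurd (LinearMap.ext fun x => ?_) hf
    have h1 := LinearMap.congr_fun hg (f.rangeRestrict x)
    rw [LinearMap.range_eq_bot.1 h] at h1
    simpa using congrArg Subtype.val h1.symm

/-- A nonzero divisible submodule splits off, hence is all of `M`. So `M` is divisible, and the pure
hull of a nonzero cyclic submodule, being divisible too, is also all of `M`. -/
theorem rank_le_one_of_divisible {M : Type*} [AddCommGroup M]
    (hM : ∀ P Q : Submodule ℤ M, IsCompl P Q → P = ⊥ ∨ Q = ⊥) (D : Submodule ℤ M)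
    (hD : ∀ n : ℕ, n ≠ 0 → ∀ x ∈ D, ∃ y ∈ D, n • y = x) (hD0 : D ≠ ⊥) :
    Module.rank ℤ M ≤ 1 := by
  have top_of (E : Submodule ℤ M) (hE : ∀ n : ℕ, n ≠ 0 → ∀ x ∈ E, ∃ y ∈ E, n • y = x)
      (hE0 : E ≠ ⊥) : E = ⊤ := by
    obtain ⟨Q, hQ⟩ := exists_isCompl_of_divisible E hE
    have := (hM _ _ hQ).resolve_left hE0
    subst this
    exact eq_top_of_isCompl_bot hQ
  obtain ⟨x, hx, hx0⟩ := D.ne_bot_iff.1 hD0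
  have hDt := top_of D hD hD0
  subst hDt
  refine rank_le_one_of_pureHull_eq_top (x := x) (top_of _ ?_ ?_)
  · rintro n hn y ⟨m, hm, hy⟩
    obtain ⟨z, -, rfl⟩ := hD n hn y trivial
    refine ⟨z, ⟨m * n, by simp [hm, hn], ?_⟩, rfl⟩
    rwa [mul_smul, natCast_zsmul]
  · exact (Submodule.ne_bot_iff _).2
      ⟨x, Submodule.le_pureHull _ (Submodule.mem_span_singleton_self x), hx0⟩

/-! ### Torsion in an indecomposable abelian group. -/

section Primary

variable {M : Type*} [AddCommGroup M] {p : ℕ}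

/-- The elements of `M` killed by a power of `p`. -/
def primaryPart (M : Type*) [AddCommGroup M] (p : ℕ) : Submodule ℤ M where
  carrier := {m | ∃ k, p ^ k • m = 0}
  zero_mem' := ⟨0, by simp⟩
  add_mem' := by
    rintro a b ⟨k, ha⟩ ⟨l, hb⟩
    refine ⟨k + l, ?_⟩
    rw [smul_add, pow_add, mul_comm, mul_smul, ha, mul_comm, mul_smul, hb]
    simp
  smul_mem' := by
    rintro c a ⟨k, ha⟩
    exact ⟨k, by rw [smul_comm, ha, smul_zero]⟩

theorem exists_smul_eq_of_mem_primaryPart (hp : p.Prime)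
    (hA : ∀ x : M, p • x = 0 → ∀ k, ∃ y, p ^ k • y = x) (n : ℕ) (hn : n ≠ 0) (x : M)
    (hx : x ∈ primaryPart M p) : ∃ y ∈ primaryPart M p, n • y = x := by
  have hp1 (k : ℕ) : ∀ x : M, p ^ k • x = 0 → ∃ y, p • y = x := by
    induction k with
    | zero => exact fun x hx => ⟨0, by simpa using hx.symm⟩
    | succ k ih =>
      intro x hx
      -- The element `p ^ k • x` is killed by `p`, so it equals `p ^ (k + 1) • z`. Then `x - p • z`
      -- is killed by `p ^ k`, which is the induction hypothesis.
      obtain ⟨z, hz⟩ := hA (p ^ k • x) (by rwa [← mul_smul, ← pow_succ']) (k + 1)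
      obtain ⟨y, hy⟩ := ih (x - p • z) (by rw [smul_sub, ← mul_smul, ← pow_succ, hz, sub_self])
      exact ⟨y + z, by rw [smul_add, hy, sub_add_cancel]⟩
  induction n using induction_on_primes generalizing x with
  | zero => exact absurd rfl hn
  | one => exact ⟨x, hx, one_smul _ _⟩
  | prime_mul q a hq ih =>
    have ha : a ≠ 0 := right_ne_zero_of_mul hn
    suffices ∃ y ∈ primaryPart M p, q • y = x by
      obtain ⟨y, hy, rfl⟩ := this
      obtain ⟨z, hz, rfl⟩ := ih ha y hy
      exact ⟨z, hz, mul_smul _ _ _⟩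
    obtain ⟨k, hk⟩ := hx
    by_cases hqp : q = p
    · subst hqp
      obtain ⟨y, hy⟩ := hp1 k x hk
      exact ⟨y, ⟨k + 1, by rw [pow_succ, mul_smul, hy, hk]⟩, hy⟩
    · have hcop : IsCoprime ((p ^ k : ℕ) : ℤ) (q : ℤ) :=
        Nat.isCoprime_iff_coprime.2 (((Nat.coprime_primes hp hq).2 (Ne.symm hqp)).pow_left k)
      obtain ⟨u, v, huv⟩ := hcop
      refine ⟨v • x, (primaryPart M p).smul_mem _ ⟨k, hk⟩, ?_⟩
      have := congrArg (· • x) huv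
      rw [smul_comm]
      simpa only [add_smul, mul_smul, natCast_zsmul, hk, smul_zero, zero_add, one_smul] using this

theorem mem_of_smul_mem_of_not_dvd (hp : p.Prime) {H : Submodule ℤ M} {x : M} (hpx : p • x ∈ H)
    {u : ℤ} (hu : ¬ (p : ℤ) ∣ u) (hux : u • x ∈ H) : x ∈ H := by
  obtain ⟨a, b, hab⟩ := ((Nat.prime_iff_prime_int.1 hp).coprime_iff_not_dvd.2 hu)
  have := congrArg (· • x) hab
  simp only [add_smul, mul_smul, one_smul, natCast_zsmul] at this
  rw [← this]
  exact H.add_mem (H.smul_mem _ hpx) (H.smul_mem _ hux)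

/-- The complement is a submodule maximal among those that contain `p ^ (j + 1) • M` and miss `x = p
^ j • y`. Any multiple of `x` prime to `p` is missed as well, since `p • x = 0`. -/
theorem exists_isCompl_span_singleton (hp : p.Prime) {j : ℕ} {y : M}
    (hy : p • p ^ j • y = 0) (hj : ∀ z, p ^ (j + 1) • z ≠ p ^ j • y) :
    ∃ H : Submodule ℤ M, (∀ m, p ^ (j + 1) • m ∈ H) ∧ IsCompl (Submodule.span ℤ {y}) H := by
  set x := p ^ j • y with hx
  obtain ⟨H, -, ⟨hH1, hH2⟩, hmax⟩ := zorn_le_nonempty₀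
    {H : Submodule ℤ M | (∀ m, p ^ (j + 1) • m ∈ H) ∧ x ∉ H} (by
      intro c hc hchain A hA
      refine ⟨sSup c, ⟨fun m => le_sSup hA ((hc hA).1 m), fun hxc => ?_⟩, fun _ h => le_sSup h⟩
      rw [Submodule.mem_sSup_of_directed ⟨A, hA⟩ hchain.directedOn] at hxc
      obtain ⟨B, hB, hxB⟩ := hxc
      exact (hc hB).2 hxB)
    (LinearMap.range (LinearMap.lsmul ℤ M ((p ^ (j + 1) : ℕ) : ℤ)))
    ⟨fun m => ⟨m, by simp [← natCast_zsmul]⟩, by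
      rintro ⟨z, hz⟩
      exact hj z (by rw [← hz, LinearMap.lsmul_apply, natCast_zsmul])⟩
  have hpx : p • x ∈ H := by rw [hy]; exact H.zero_mem
  refine ⟨H, hH1, ?_⟩
  rw [isCompl_iff, Submodule.disjoint_def, codisjoint_iff]
  constructor
  · intro z hz hzH
    obtain ⟨a, rfl⟩ := Submodule.mem_span_singleton.1 hz
    have hdvd : ∀ i ≤ j + 1, ((p ^ i : ℕ) : ℤ) ∣ a := by
      intro i
      induction i with
      | zero => simp
      | succ i ih =>
        intro hi
        obtain ⟨u, rfl⟩ := ih (by omega)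
        by_cases hu : (p : ℤ) ∣ u
        · obtain ⟨v, rfl⟩ := hu
          exact ⟨v, by push_cast; ring⟩
        · refine absurd (mem_of_smul_mem_of_not_dvd hp hpx hu ?_) hH2
          have : u • x = ((p ^ (j - i) : ℕ) : ℤ) • (((p ^ i : ℕ) : ℤ) * u) • y := by
            rw [hx, ← natCast_zsmul, ← mul_smul, ← mul_smul, ← mul_assoc, ← Nat.cast_mul,
              ← pow_add, Nat.sub_add_cancel (by omega), mul_comm]
          rw [this]
          exact H.smul_mem _ hzH
    obtain ⟨u, rfl⟩ := hdvd (j + 1) le_rfl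
    rw [mul_comm, mul_smul, natCast_zsmul, pow_succ', mul_smul, hy, smul_zero]
  -- Since `p ^ (j + 1) • M` lies in `H`, it is enough that the sum is closed under division by `p`.
  · have step (g : M) (hg : p • g ∈ Submodule.span ℤ {y} ⊔ H) :
        g ∈ Submodule.span ℤ {y} ⊔ H := by
      obtain ⟨_, ha, h, hh, hg⟩ := Submodule.mem_sup.1 hg
      obtain ⟨a, rfl⟩ := Submodule.mem_span_singleton.1 ha
      have hpa : (p : ℤ) ∣ a := by
        by_contra hpa
        refine hH2 (mem_of_smul_mem_of_not_dvd hp hpx hpa ?_)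
        have : a • x = p ^ (j + 1) • g - p ^ j • h := by
          rw [pow_succ, mul_smul, ← hg, smul_add, add_sub_cancel_right, hx, smul_comm]
        rw [this]
        exact H.sub_mem (hH1 _) (H.smul_of_tower_mem _ hh)
      obtain ⟨b, rfl⟩ := hpa
      by_contra hcon
      set g' := g - b • y with hg'
      have hpg' : p • g' ∈ H := by
        rw [hg', smul_sub, ← hg, mul_smul, natCast_zsmul, add_sub_cancel_left]
        exact hh
      have hg'g : g = b • y + g' := by simp [hg']
      have hg'N : g' ∉ Submodule.span ℤ {y} ⊔ H := fun h => hcon <| by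
        rw [hg'g]
        exact Submodule.add_mem _ (Submodule.mem_sup_left
          (Submodule.smul_mem _ _ (Submodule.mem_span_singleton_self y))) h
      -- Adjoining `g'` to `H` enlarges it, so maximality forces `x` into the larger submodule.
      have hxmem : x ∈ H ⊔ Submodule.span ℤ {g'} := by
        by_contra hxn
        have := hmax (y := H ⊔ Submodule.span ℤ {g'})
          ⟨fun m => Submodule.mem_sup_left (hH1 m), hxn⟩ le_sup_left
        exact hg'N (Submodule.mem_sup_right
          (this (Submodule.mem_sup_right (Submodule.mem_span_singleton_self _))))
      obtain ⟨h', hh', _, hc, hxe⟩ := Submodule.mem_sup.1 hxmem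
      obtain ⟨c, rfl⟩ := Submodule.mem_span_singleton.1 hc
      have hpc : ¬ (p : ℤ) ∣ c := by
        rintro ⟨d, rfl⟩
        refine hH2 (hxe ▸ H.add_mem hh' ?_)
        rw [mul_comm, mul_smul, natCast_zsmul]
        exact H.smul_mem _ hpg'
      refine hg'N (mem_of_smul_mem_of_not_dvd hp (Submodule.mem_sup_right hpg') hpc ?_)
      rw [← eq_sub_iff_add_eq'] at hxe
      rw [hxe]
      refine Submodule.sub_mem _ (Submodule.mem_sup_left ?_) (Submodule.mem_sup_right hh')
      exact Submodule.smul_of_tower_mem _ _ (Submodule.mem_span_singleton_self y)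
    refine Submodule.eq_top_iff'.2 fun g => ?_
    have : ∀ i, ∀ g : M, p ^ i • g ∈ Submodule.span ℤ {y} ⊔ H →
        g ∈ Submodule.span ℤ {y} ⊔ H := by
      intro i
      induction i with
      | zero => simp
      | succ i ih => exact fun g hg => ih g (step _ (by rwa [← mul_smul, ← pow_succ']))
    exact this (j + 1) g (Submodule.mem_sup_right (hH1 g))

/-- If every element of order `p` is divisible by all powers of `p`, the primary part is divisible
and splits off, hence is everything. Otherwise some element of order `p` has finite height `j`, and
a cyclic summand results. Its complement must vanish and contains `p ^ (j + 1) • M`. -/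
theorem exists_pow_smul_eq_zero_of_indecomposable
    (hM : ∀ P Q : Submodule ℤ M, IsCompl P Q → P = ⊥ ∨ Q = ⊥) (hp : p.Prime) {x : M}
    (hx0 : x ≠ 0) (hpx : p • x = 0) (m : M) : ∃ k, p ^ k • m = 0 := by
  classical
  by_cases hA : ∀ x : M, p • x = 0 → ∀ k, ∃ y, p ^ k • y = x
  · obtain ⟨Q, hQ⟩ := exists_isCompl_of_divisible (primaryPart M p)
      (exists_smul_eq_of_mem_primaryPart hp hA)
    have hQ0 := (hM _ _ hQ).resolve_left
      ((Submodule.ne_bot_iff _).2 ⟨x, ⟨1, by simpa using hpx⟩, hx0⟩)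
    subst hQ0
    have : m ∈ primaryPart M p := eq_top_of_isCompl_bot hQ ▸ Submodule.mem_top
    exact this
  · push Not at hA
    obtain ⟨x, hpx, hk⟩ := hA
    obtain ⟨j, hj⟩ := Nat.exists_eq_succ_of_ne_zero
      (show Nat.find hk ≠ 0 from fun h => (Nat.find_eq_zero hk).1 h x (by simp))
    have hspec := Nat.find_spec hk
    rw [hj] at hspec
    obtain ⟨y, rfl⟩ : ∃ y, p ^ j • y = x := by
      simpa using Nat.find_min hk (show j < Nat.find hk by omega)
    obtain ⟨H, hH, hc⟩ := exists_isCompl_span_singleton hp hpx hspec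
    rcases hM _ _ hc with h | h
    · rw [Submodule.span_singleton_eq_bot] at h
      exact absurd (by simp [h]) (hspec 0)
    · exact ⟨j + 1, by simpa [h] using hH m⟩

end Primary

/-! ### Consecutive prime powers. -/

/-- The cofactor of `x - 1` is a sum of `k` odd terms, hence odd. As a divisor of a power of 2 it is
±1. -/
theorem Int.natAbs_pow_sub_one_eq_of_eq_two_pow {x : ℤ} (hx : Odd x) {k n : ℕ} (hk : Odd k)
    (h : (x ^ k - 1).natAbs = 2 ^ n) : (x ^ k - 1).natAbs = (x - 1).natAbs := by
  have hS : Odd (∑ i ∈ Finset.range k, x ^ i) := by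
    have h2 : Even (∑ i ∈ Finset.range k, (x ^ i - 1)) :=
      Finset.even_sum _ fun i _ => hx.pow.sub_odd odd_one
    rw [Finset.sum_sub_distrib, Int.even_sub'] at h2
    exact h2.2 (by simpa using hk)
  rw [← mul_geom_sum, Int.natAbs_mul] at h ⊢
  have : (∑ i ∈ Finset.range k, x ^ i).natAbs = 1 :=
    Nat.Coprime.eq_one_of_dvd ((Nat.coprime_two_right.2 (Int.natAbs_odd.2 hS)).pow_right n)
      (h ▸ Dvd.intro_left _ rfl)
  rw [this, mul_one]

/-- For positive exponents, parity forces `l = 2` or `p = 2`. Odd exponents on the odd prime reduce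
to exponent 1, and even ones are settled modulo 4 or by a difference of squares. The 9 allows for 9
= 8 + 1. -/
theorem Nat.le_of_prime_pow_eq_prime_pow_add_one {l p n k : ℕ} (hl : l.Prime) (hp : p.Prime)
    (h : l ^ n = p ^ k + 1) : l ^ n ≤ l + p + 9 := by
  rcases Nat.eq_zero_or_pos n with rfl | hn
  · simp
  rcases Nat.eq_zero_or_pos k with rfl | hk
  · rw [h]; simp
  rcases hl.eq_two_or_odd' with rfl | hlo
  · have hpo : Odd p := by
      by_contra hpe
      have h1 : Even (2 ^ n) := (Nat.even_pow.2 ⟨even_two, hn.ne'⟩)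
      rw [h] at h1
      have h2 : Even (p ^ k) := (Nat.not_odd_iff_even.1 hpe).pow_of_ne_zero hk.ne'
      exact Nat.not_even_iff_odd.2 h2.add_one h1
    rcases Nat.even_or_odd k with ⟨m, rfl⟩ | hko
    · have h4 : p ^ (m + m) % 4 = 1 := by
        rw [← two_mul, pow_mul', pow_two, Nat.mul_mod]
        have : Odd (p ^ m) := hpo.pow
        have : p ^ m % 4 = 1 ∨ p ^ m % 4 = 3 := by
          have := Nat.odd_iff.1 this
          omega
        rcases this with h | h <;> simp [h]
      have : n < 2 := by
        by_contra hn2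
        have : 4 ∣ 2 ^ n := pow_dvd_pow 2 (not_lt.1 hn2)
        omega
      have : n = 1 := by omega
      subst this
      omega
    · have hc : ((p ^ k : ℕ) : ℤ) = (p : ℤ) ^ k := Nat.cast_pow p k
      -- With `k` odd, `(-p) ^ k - 1 = -2 ^ n`, so the sign change turns `p ^ k + 1` into the form
      -- needed and gives `2 ^ n = p + 1`.
      have := Int.natAbs_pow_sub_one_eq_of_eq_two_pow (x := -p) (n := n) (k := k)
        (by simpa using hpo) hko (by rw [hko.neg_pow, h]; omega)
      rw [hko.neg_pow] at this
      omega
  · have hp2 : p = 2 := by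
      rcases hp.eq_two_or_odd' with rfl | hpo
      · rfl
      · exact absurd (h ▸ hlo.pow : Odd (p ^ k + 1)) (Nat.not_odd_iff_even.2 hpo.pow.add_one)
    subst hp2
    have h' : (l : ℤ) ^ n - 1 = 2 ^ k := by
      have := congrArg (Nat.cast (R := ℤ)) h
      push_cast at this
      linarith
    rcases Nat.even_or_odd n with ⟨m, rfl⟩ | hno
    · have hfac : (l ^ m + 1) * (l ^ m - 1) = 2 ^ k := by
        rw [← Nat.sq_sub_sq, ← pow_mul, mul_two, h]; simp
      obtain ⟨a, -, ha⟩ := (Nat.dvd_prime_pow Nat.prime_two).1 (Dvd.intro_left _ hfac)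
      obtain ⟨b, -, hb⟩ := (Nat.dvd_prime_pow Nat.prime_two).1 (Dvd.intro _ hfac)
      have hlm : 2 ≤ l ^ m := hl.two_le.trans (Nat.le_self_pow (by omega) l)
      have ha2 : a < 2 := by
        by_contra ha2
        have h1 : 4 ∣ 2 ^ a := pow_dvd_pow 2 (not_lt.1 ha2)
        have hb2 : 2 < b := (Nat.pow_lt_pow_iff_right one_lt_two).1
          (show 2 ^ 2 < 2 ^ b by
            have := Nat.le_of_dvd (by positivity) h1
            omega)
        have h2 : 4 ∣ 2 ^ b := pow_dvd_pow 2 hb2.le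
        omega
      have : l ^ m ≤ 3 := by
        have : 2 ^ a ≤ 2 ^ 1 := Nat.pow_le_pow_right two_pos (by omega)
        omega
      rw [pow_add]
      nlinarith
    · have := Int.natAbs_pow_sub_one_eq_of_eq_two_pow (x := l) (n := k) (k := n)
        (by simpa using hlo) hno (by rw [h']; simp [Int.natAbs_pow])
      have hl1 := hl.one_lt
      have : l ^ n = l := by
        rw [h'] at this
        simp only [Int.natAbs_pow, Int.reduceAbs] at this
        have h3 : (2 : ℤ).natAbs ^ k = 2 ^ k := rfl
        omega
      omega

/-! ### Fields with indecomposable or torsion-free unit group. -/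

theorem finite_of_forall_unit_pow_prime_pow_eq_one {F : Type*} [Field F] {p : ℕ} (hp : p.Prime)
    (h : ∀ u : Fˣ, ∃ k, u ^ p ^ k = 1) : Finite F := by
  by_contra hfin
  rw [not_finite_iff_infinite] at hfin
  have h' (x : F) (hx : x ≠ 0) : ∃ k, x ^ p ^ k = 1 := by
    obtain ⟨k, hk⟩ := h (Units.mk0 x hx)
    exact ⟨k, by simpa using congrArg Units.val hk⟩
  obtain ⟨l, hl⟩ := CharP.exists F
  rcases CharP.char_is_prime_or_zero F l with hlp | rfl
  swap
  · have := CharP.charP_to_charZero F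
    obtain ⟨k, hk⟩ := h' 2 two_ne_zero
    have : 2 ^ p ^ k = 1 := by exact_mod_cast hk
    simp [hp.ne_zero] at this
  have := Fact.mk hlp
  let _ := ZMod.algebra F l
  have hint (x : F) : IsIntegral (ZMod l) x := by
    rcases eq_or_ne x 0 with rfl | hx
    · exact isIntegral_zero
    · obtain ⟨k, hk⟩ := h' x hx
      exact IsIntegral.of_pow (pow_pos hp.pos k) (hk ▸ isIntegral_one)
  -- One element more than the bound on consecutive prime powers allows for the finite subfield
  -- generated by `T`.
  obtain ⟨T, hT⟩ := Infinite.exists_subset_card_eq F (l + p + 10)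
  let K := IntermediateField.adjoin (ZMod l) (T : Set F)
  have : FiniteDimensional (ZMod l) K :=
    IntermediateField.finiteDimensional_adjoin fun x _ => hint x
  have : Finite K := Module.finite_of_finite (ZMod l)
  have := Fintype.ofFinite K
  have hTK : l + p + 10 ≤ Nat.card K := by
    rw [← hT, ← Set.ncard_coe_finset]
    exact Set.ncard_le_ncard (IntermediateField.subset_adjoin _ _) (Set.toFinite (K : Set F))
  obtain ⟨n, -, hn⟩ := FiniteField.card K l
  have hpg : IsPGroup p Kˣ := by
    intro u
    obtain ⟨k, hk⟩ := h' (u : K) (by simp)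
    exact ⟨k, by ext; simpa using hk⟩
  have := Fact.mk hp
  obtain ⟨k, hk⟩ := IsPGroup.iff_card.1 hpg
  rw [Nat.card_units, Nat.card_eq_fintype_card] at hk
  rw [Nat.card_eq_fintype_card] at hTK
  have := Nat.le_of_prime_pow_eq_prime_pow_add_one hlp hp (n := n) (k := k) (by omega)
  omega

theorem isMulTorsionFree_units_of_isIndecomposableGroup {F : Type*} [Field F] [Infinite F]
    (hF : IsIndecomposableGroup Fˣ) : IsMulTorsionFree Fˣ := by
  have key (p : ℕ) (hp : p.Prime) (u : Fˣ) (hu : u ^ p = 1) : u = 1 := by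
    by_contra hu1
    refine not_finite_iff_infinite.2 ‹Infinite F›
      (finite_of_forall_unit_pow_prime_pow_eq_one hp fun v => ?_)
    exact exists_pow_smul_eq_zero_of_indecomposable (M := Additive Fˣ) hF.eq_bot_of_isCompl hp
      (x := Additive.ofMul u) hu1 hu (Additive.ofMul v)
  have key2 (n : ℕ) (hn : n ≠ 0) : ∀ u : Fˣ, u ^ n = 1 → u = 1 := by
    induction n using induction_on_primes with
    | zero => exact absurd rfl hn
    | one => simp
    | prime_mul q a hq ih =>
      exact fun u hu => ih (right_ne_zero_of_mul hn) u (key q hq _ (by rwa [← pow_mul, mul_comm]))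
  refine ⟨fun n hn x y hxy => ?_⟩
  have := key2 n hn (x / y) (by rw [div_pow]; exact div_eq_one.2 hxy)
  exact div_eq_one.1 this

theorem charP_two_of_isMulTorsionFree_units {F : Type*} [Field F] [IsMulTorsionFree Fˣ] :
    CharP F 2 := by
  have h : (-1 : Fˣ) = 1 := IsMulTorsionFree.pow_left_injective two_ne_zero (by simp)
  have h2 : (-1 : F) = 1 := congrArg Units.val h
  exact CharTwo.of_one_ne_zero_of_two_eq_zero one_ne_zero (by
    rw [← one_add_one_eq_two]; nth_rw 1 [← h2]; simp)

theorem eq_one_of_isAlgebraic_of_isMulTorsionFree_units {K F : Type*} [Field K] [Finite K]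
    [Field F] [Algebra K F] [IsMulTorsionFree Fˣ] {x : F} (hx : IsAlgebraic K x) (hx0 : x ≠ 0) :
    x = 1 := by
  let E := IntermediateField.adjoin K {x}
  have : FiniteDimensional K E := IntermediateField.adjoin.finiteDimensional hx.isIntegral
  have : Finite E := Module.finite_of_finite K
  have := Fintype.ofFinite E
  let y : E := ⟨x, IntermediateField.mem_adjoin_simple_self K x⟩
  have hy0 : y ≠ 0 := fun h => hx0 (congrArg Subtype.val h)
  have hy := congrArg Subtype.val (FiniteField.pow_card_sub_one_eq_one y hy0)
  have h1 : (Units.mk0 x hx0) ^ (Fintype.card E - 1) = 1 := by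
    ext; simpa [y] using hy
  have hc : Fintype.card E - 1 ≠ 0 := by
    have := Fintype.one_lt_card (α := E); omega
  have : Units.mk0 x hx0 = 1 := IsMulTorsionFree.pow_left_injective hc (by simpa using h1)
  simpa using congrArg Units.val this

theorem isCompletelyTranscendentalExtension_of_isMulTorsionFree_units {K F : Type*} [Field K]
    [Finite K] [Field F] [Algebra K F] [IsMulTorsionFree Fˣ] :
    IsCompletelyTranscendentalExtension K F := by
  intro x hx h
  rcases eq_or_ne x 0 with rfl | hx0
  · exact hx ⟨0, map_zero _⟩
  · exact hx ⟨1, by rw [map_one, eq_one_of_isAlgebraic_of_isMulTorsionFree_units h hx0]⟩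

theorem not_isAlgClosed_of_isMulTorsionFree_units {F : Type*} [Field F] [IsMulTorsionFree Fˣ] :
    ¬ IsAlgClosed F := by
  intro _
  have := charP_two_of_isMulTorsionFree_units (F := F)
  have : NeZero (3 : F) := ⟨by
    have : (3 : F) = 1 := by
      have h2 : (2 : F) = 0 := CharTwo.two_eq_zero
      linear_combination h2
    rw [this]; exact one_ne_zero⟩
  have : NeZero ((3 : ℕ) : F) := by simpa using this
  obtain ⟨z, hz⟩ := HasEnoughRootsOfUnity.exists_primitiveRoot F 3
  have hu := (hz.isUnit (by norm_num))
  have h1 : hu.unit = 1 := IsMulTorsionFree.pow_left_injective (n := 3) (by norm_num)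
    (by ext; simpa using hz.pow_eq_one)
  exact hz.ne_one (by norm_num) (by simpa using congrArg Units.val h1)

/-! ### Unit groups of fraction fields and of purely transcendental extensions. -/

section UniqueFactorization

variable {R : Type*} [CommRing R] [UniqueFactorizationMonoid R] [Subsingleton Rˣ]

/-- An irreducible with positive exponent divides the left side, hence a factor on the right.
Associates are equal here, so that factor would be its own power, with exponent 0. -/
theorem not_pos_of_prod_toNat_eq {s : Finset {p : R // Irreducible p}}
    {g : {p : R // Irreducible p} → ℤ}
    (h : ∏ i ∈ s, (i : R) ^ (g i).toNat = ∏ i ∈ s, (i : R) ^ (-g i).toNat)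
    {i : {p : R // Irreducible p}} (hi : i ∈ s) : ¬ 0 < g i := by
  intro hpos
  have hd : (i : R) ∣ ∏ i ∈ s, (i : R) ^ (-g i).toNat := by
    rw [← h]
    exact (dvd_pow_self _ (by omega)).trans
      (Finset.dvd_prod_of_mem (fun i : {p : R // Irreducible p} => (i : R) ^ (g i).toNat) hi)
  have hip := i.2.prime
  obtain ⟨j, -, hj⟩ := hip.exists_mem_finset_dvd hd
  have hij : i = j := Subtype.ext
    (associated_iff_eq.1 (i.2.associated_of_dvd j.2 (hip.dvd_of_dvd_pow hj)))
  subst hij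
  rw [Int.toNat_of_nonpos (by omega), pow_zero] at hj
  exact hip.not_dvd_one hj

variable {K : Type*} [Field K] [Algebra R K] [IsFractionRing R K]

/-- A nonzero element of `R` as a unit of the fraction field `K`, written additively. -/
noncomputable def fractionUnit (K : Type*) [Field K] [Algebra R K] [IsFractionRing R K] (a : R)
    (ha : a ≠ 0) : Additive Kˣ :=
  Additive.ofMul (Units.mk0 (algebraMap R K a) (by simpa using ha))

theorem linearIndependent_fractionUnit :
    LinearIndependent ℤ fun p : {p : R // Irreducible p} => fractionUnit K (p : R) p.2.ne_zero := by
  rw [linearIndependent_iff']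
  intro s g hg
  have h1 : ∏ i ∈ s, algebraMap R K i ^ g i = 1 := by
    have := congrArg (fun x => ((Additive.toMul x : Kˣ) : K)) hg
    simpa [fractionUnit] using this
  have h2 : ∏ i ∈ s, (i : R) ^ (g i).toNat = ∏ i ∈ s, (i : R) ^ (-g i).toNat := by
    apply IsFractionRing.injective R K
    rw [map_prod, map_prod, ← one_mul (∏ i ∈ s, algebraMap R K (i ^ (-g i).toNat)), ← h1,
      ← Finset.prod_mul_distrib]
    refine Finset.prod_congr rfl fun i _ => ?_
    have hi : algebraMap R K i ≠ 0 := by simpa using i.2.ne_zero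
    rw [map_pow, map_pow, ← zpow_natCast, ← zpow_natCast, ← zpow_add₀ hi]
    congr 1
    omega
  intro i hi
  have h3 := not_pos_of_prod_toNat_eq h2 hi
  have h4 := not_pos_of_prod_toNat_eq (g := fun i => -g i) (by simpa using h2.symm) hi
  omega

variable [IsDomain R]

/-- Euclid's argument works because 1 is the only unit: `N + 1` is a unit only if `N = 0`. -/
theorem infinite_irreducible {x : R} (hx0 : x ≠ 0) (hx : ¬ IsUnit x) :
    Infinite {p : R // Irreducible p} := by
  classical
  by_contra hfin
  rw [not_infinite_iff_finite] at hfin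
  have := Fintype.ofFinite {p : R // Irreducible p}
  obtain ⟨q, hq, -⟩ := WfDvdMonoid.exists_irreducible_factor hx hx0
  have hN (p : R) (hp : Irreducible p) : p ∣ ∏ r : {p : R // Irreducible p}, (r : R) :=
    Finset.dvd_prod_of_mem (fun r : {p : R // Irreducible p} => (r : R))
      (Finset.mem_univ ⟨p, hp⟩)
  set N := ∏ r : {p : R // Irreducible p}, (r : R)
  have hN1 : ¬ IsUnit N := fun h => hq.not_isUnit (isUnit_of_dvd_unit (hN q hq) h)
  have hN0 : N ≠ 0 := Finset.prod_ne_zero_iff.2 fun r _ => r.2.ne_zero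
  have h1 : ¬ IsUnit (N + 1) := fun h => by
    rw [isUnit_iff_eq_one] at h
    exact hN0 (by simpa using h)
  have h0 : N + 1 ≠ 0 := fun h => hN1 (by
    rw [eq_neg_of_add_eq_zero_left h]; exact isUnit_one.neg)
  obtain ⟨p, hp, hpd⟩ := WfDvdMonoid.exists_irreducible_factor h1 h0
  exact hp.not_isUnit (isUnit_of_dvd_one ((dvd_add_right (hN p hp)).1 hpd))

theorem span_range_fractionUnit :
    Submodule.span ℤ (Set.range fun p : {p : R // Irreducible p} =>
      fractionUnit K (p : R) p.2.ne_zero) = ⊤ := by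
  have key (a : R) : ∀ ha : a ≠ 0, fractionUnit K a ha ∈
      Submodule.span ℤ (Set.range fun p : {p : R // Irreducible p} =>
        fractionUnit K (p : R) p.2.ne_zero) := by
    induction a using UniqueFactorizationMonoid.induction_on_prime with
    | h₁ => exact fun h => absurd rfl h
    | h₂ a ha =>
      intro h
      rw [isUnit_iff_eq_one] at ha
      subst ha
      convert Submodule.zero_mem _
      simp [fractionUnit]
    | h₃ a p ha hp ih =>
      intro h
      have : fractionUnit K (p * a) h = fractionUnit K p hp.ne_zero + fractionUnit K a ha := by
        apply Additive.toMul.injective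
        ext
        simp [fractionUnit]
      rw [this]
      exact Submodule.add_mem _ (Submodule.subset_span ⟨⟨p, hp.irreducible⟩, rfl⟩) (ih ha)
  refine Submodule.eq_top_iff'.2 fun x => ?_
  obtain ⟨a, b, hb, hab⟩ := IsFractionRing.div_surjective (A := R) ((Additive.toMul x : Kˣ) : K)
  have hb0 := nonZeroDivisors.ne_zero hb
  have ha0 : a ≠ 0 := by
    rintro rfl
    simp at hab
    exact (Additive.toMul x).ne_zero hab.symm
  have : x = fractionUnit K a ha0 - fractionUnit K b hb0 := by
    apply Additive.toMul.injective
    ext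
    simp [fractionUnit, hab]
  rw [this]
  exact Submodule.sub_mem _ (key a ha0) (key b hb0)

variable (R K) in
/-- The irreducible elements form a basis of the group of units of the fraction field of a unique
factorization domain without nontrivial units. -/
noncomputable def unitsFractionFieldBasis :
    Module.Basis {p : R // Irreducible p} ℤ (Additive Kˣ) :=
  Module.Basis.mk linearIndependent_fractionUnit span_range_fractionUnit.ge

end UniqueFactorization

theorem IsPurelyTranscendentalExtension.exists_algEquiv {k E : Type*} [Field k] [Field E]
    [Algebra k E] (h : IsPurelyTranscendentalExtension k E)
    (hne : (⊥ : IntermediateField k E) ≠ ⊤) :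
    ∃ s : Set E, s.Nonempty ∧ Nonempty (FractionRing (MvPolynomial s k) ≃ₐ[k] E) := by
  obtain ⟨s, hs, htop⟩ := h
  refine ⟨s, Set.nonempty_iff_ne_empty.2 ?_, ?_⟩
  · rintro rfl
    exact hne (by rw [← htop, IntermediateField.adjoin_empty])
  · have htop' : IntermediateField.adjoin k (Set.range ((↑) : s → E)) = ⊤ := by
      rwa [Subtype.range_coe]
    exact ⟨(hs.aevalEquivField.trans (IntermediateField.equivOfEq htop')).trans
      IntermediateField.topEquiv⟩

theorem IsPurelyTranscendentalExtension.isFreeAbelian_units {k E : Type*} [Field k]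
    [Subsingleton kˣ] [Field E] [Algebra k E] (h : IsPurelyTranscendentalExtension k E)
    (hne : (⊥ : IntermediateField k E) ≠ ⊤) : IsFreeAbelian Eˣ ∧ HasInfiniteRank Eˣ := by
  obtain ⟨s, ⟨i, hi⟩, ⟨e⟩⟩ := h.exists_algEquiv hne
  have : Subsingleton (MvPolynomial s k)ˣ := by
    have key (u : (MvPolynomial s k)ˣ) : (u : MvPolynomial s k) = 1 := by
      obtain ⟨r, hr, hu⟩ := MvPolynomial.isUnit_iff_eq_C_of_isReduced.1 u.isUnit
      rw [hu, isUnit_iff_eq_one.1 hr, map_one]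
    exact ⟨fun u v => Units.ext ((key u).trans (key v).symm)⟩
  let b := (unitsFractionFieldBasis (MvPolynomial s k) (FractionRing (MvPolynomial s k))).map
    (MulEquiv.toAdditive
      (Units.mapEquiv (e : FractionRing (MvPolynomial s k) ≃* E))).toIntLinearEquiv
  have : Infinite {p : MvPolynomial s k // Irreducible p} := by
    refine infinite_irreducible (MvPolynomial.X_ne_zero ⟨i, hi⟩) fun hX => ?_
    have := congrArg MvPolynomial.totalDegree (isUnit_iff_eq_one.1 hX)
    simp at this
  refine ⟨Module.Free.of_basis b, ?_⟩
  have hb := b.mk_eq_rank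
  have : Cardinal.aleph0 ≤
      Cardinal.lift.{_} (Cardinal.mk {p : MvPolynomial s k // Irreducible p}) :=
    Cardinal.aleph0_le_lift.2 (Cardinal.aleph0_le_mk _)
  rw [hb, Cardinal.aleph0_le_lift] at this
  exact this

/-! ### Essential unions of subgroups with large free summands. -/

/-- Greedy selection by transfinite recursion: `a` is taken when it is compatible with all earlier
choices. -/
theorem exists_selection_of_wellFounded {α : Type*} {r : α → α → Prop} (hr : WellFounded r)
    (p : α → Prop) (q : α → α → Prop) :
    ∃ S : α → Prop, ∀ a, S a ↔ p a ∧ ∀ b, r b a → S b → q b a := by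
  refine ⟨hr.fix fun a ih => p a ∧ ∀ b, ∀ h : r b a, ih b h → q b a, fun a => ?_⟩
  rw [hr.fix_eq]

theorem Cardinal.mk_biUnion_finset_lt {α : Type u} [Infinite α] {s : Set α}
    (hs : Cardinal.mk s < Cardinal.mk α) (f : α → Finset α) :
    Cardinal.mk (⋃ x ∈ s, (f x : Set α) : Set α) < Cardinal.mk α := by
  rcases s.finite_or_infinite with hfin | hinf
  · exact (Cardinal.lt_aleph0_iff_set_finite.2
      (hfin.biUnion fun x _ => (f x).finite_toSet)).trans_le (Cardinal.aleph0_le_mk α)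
  · have hs' : Cardinal.aleph0 ≤ Cardinal.mk s :=
      Cardinal.infinite_iff.1 hinf.to_subtype
    refine lt_of_le_of_lt ((Cardinal.mk_biUnion_le _ s).trans ?_) hs
    calc _ ≤ Cardinal.mk s * Cardinal.aleph0 := by
            gcongr
            exact ciSup_le' fun x => (Cardinal.finset_card_lt_aleph0 _).le
      _ = Cardinal.mk s := Cardinal.mul_aleph0_eq hs'

theorem Submodule.pureHull_mono {M : Type*} [AddCommGroup M] {N P : Submodule ℤ M} (h : N ≤ P) :
    N.pureHull ≤ P.pureHull :=
  fun _ ⟨n, hn, hx⟩ => ⟨n, hn, h hx⟩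

theorem Submodule.pureHull_pureHull {M : Type*} [AddCommGroup M] (N : Submodule ℤ M) :
    N.pureHull.pureHull = N.pureHull := by
  refine le_antisymm ?_ (Submodule.le_pureHull _)
  rintro x ⟨n, hn, m, hm, hx⟩
  exact ⟨m * n, mul_ne_zero hm hn, by rwa [mul_smul]⟩

section EssentialUnion

variable {M : Type u} [AddCommGroup M] [IsAddTorsionFree M]

theorem exists_maximal_linearIndepOn_int (M : Type u) [AddCommGroup M] :
    ∃ s : Set M, LinearIndepOn ℤ id s ∧ (Submodule.span ℤ s).pureHull = ⊤ ∧
      Cardinal.mk s = Module.rank ℤ M := by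
  obtain ⟨s, hs, hmax⟩ := exists_maximal_linearIndepOn ℤ (id : M → M)
  rw [Set.image_id] at hmax
  have htop : (Submodule.span ℤ s).pureHull = ⊤ := by
    refine Submodule.eq_top_iff'.2 fun x => ?_
    by_cases hx : x ∈ s
    · exact Submodule.le_pureHull _ (Submodule.subset_span hx)
    · exact hmax x hx
  refine ⟨s, hs, htop, ?_⟩
  rw [← rank_quotient_add_rank_of_isDomain (Submodule.span ℤ s),
    rank_eq_zero_iff.2, zero_add, rank_span_set hs]
  intro y
  obtain ⟨y, rfl⟩ := Submodule.Quotient.mk_surjective _ y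
  obtain ⟨n, hn, hy⟩ := Submodule.mem_pureHull.1 (htop ▸ Submodule.mem_top : y ∈ _)
  exact ⟨n, hn, by rwa [← Submodule.Quotient.mk_smul, Submodule.Quotient.mk_eq_zero]⟩

theorem Submodule.disjoint_pureHull_left {N P : Submodule ℤ M} (h : Disjoint N P) :
    Disjoint N.pureHull P := by
  rw [Submodule.disjoint_def] at h ⊢
  rintro x ⟨n, hn, hx⟩ hxP
  exact (smul_eq_zero.1 (h _ hx (P.smul_mem n hxP))).resolve_left hn

theorem mem_pureHull_span_singleton_symm {x y : M} (hx : x ≠ 0)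
    (h : x ∈ (Submodule.span ℤ {y}).pureHull) : y ∈ (Submodule.span ℤ {x}).pureHull := by
  obtain ⟨n, hn, hxy⟩ := h
  obtain ⟨m, hm⟩ := Submodule.mem_span_singleton.1 hxy
  refine ⟨m, ?_, Submodule.mem_span_singleton.2 ⟨n, hm.symm⟩⟩
  rintro rfl
  rw [zero_smul] at hm
  exact (smul_ne_zero hn hx) hm.symm

/-- For each `g` a direct sum of the rank one pure subgroup through `g` and a free group of full
rank that is independent of everything up to `g` in a well-order. -/
theorem exists_family_sup_pureHull [Infinite M] (hrank : Module.rank ℤ M = Cardinal.mk M) :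
    ∃ (r : M → M → Prop) (_ : IsWellOrder M r) (B : M → Submodule ℤ M),
      (∀ g, Module.Free ℤ (B g) ∧ Module.rank ℤ (B g) = Cardinal.mk M) ∧
      (∀ g, Disjoint (B g) (Submodule.span ℤ {g}).pureHull) ∧
      ∀ g h, r h g → h ∈ B g ⊔ (Submodule.span ℤ {g}).pureHull →
        h ∈ (Submodule.span ℤ {g}).pureHull := by
  obtain ⟨s, hs, htop, hcard⟩ := exists_maximal_linearIndepOn_int M
  have hsupp (x : M) : ∃ T : Finset M, (T : Set M) ⊆ s ∧
      x ∈ (Submodule.span ℤ (T : Set M)).pureHull := by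
    obtain ⟨n, hn, hx⟩ := Submodule.mem_pureHull.1 (htop ▸ Submodule.mem_top : x ∈ _)
    obtain ⟨T, hT, hxT⟩ := Submodule.mem_span_finite_of_mem_span hx
    exact ⟨T, hT, n, hn, hxT⟩
  choose supp hsub hmem using hsupp
  -- In a well-order of minimal type, proper initial segments have fewer than `|M|` elements. Hence
  -- so does the set `I g` of basis elements needed up to `g`, and `|M|` of them remain to span `B
  -- g`.
  obtain ⟨r, hr, hord⟩ := Cardinal.exists_ord_eq M
  let I (g : M) : Set M := ⋃ x ∈ insert g {h | r h g}, (supp x : Set M)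
  have hI (g : M) : Cardinal.mk (I g) < Cardinal.mk M := by
    refine Cardinal.mk_biUnion_finset_lt ?_ supp
    refine Cardinal.mk_insert_le.trans_lt (Cardinal.add_lt_of_lt (Cardinal.aleph0_le_mk M) ?_
      (Cardinal.one_lt_aleph0.trans_le (Cardinal.aleph0_le_mk M)))
    exact Cardinal.card_typein_lt (r := r) g hord
  have hIs (g : M) : I g ⊆ s := Set.iUnion₂_subset fun x _ => hsub x
  have hJ (g : M) : Cardinal.mk (s \ I g : Set M) = Cardinal.mk M := by
    refine le_antisymm (Cardinal.mk_set_le _) (not_lt.1 fun hlt => ?_)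
    have := Cardinal.add_lt_of_lt (Cardinal.aleph0_le_mk M) hlt (hI g)
    rw [Cardinal.mk_sdiff_add_mk (hIs g), hcard, hrank] at this
    exact this.false
  have hli (g : M) : LinearIndepOn ℤ id (s \ I g) := hs.mono Set.sdiff_subset
  have hdisj (g : M) : Disjoint (Submodule.span ℤ (I g)).pureHull (Submodule.span ℤ (s \ I g)) := by
    apply Submodule.disjoint_pureHull_left
    have h1 := LinearIndependent.disjoint_span_image hs (s := {x | (x : M) ∈ I g})
      (t := {x | (x : M) ∉ I g}) (Set.disjoint_left.2 fun x hx hx' => hx' hx)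
    convert h1 using 2
    · ext x
      simp only [Set.mem_image, Set.mem_ofPred_eq, Subtype.exists, id]
      exact ⟨fun hx => ⟨x, hIs g hx, hx, rfl⟩, by rintro ⟨_, -, hx, rfl⟩; exact hx⟩
    · ext x
      simp only [Set.mem_image, Set.mem_ofPred_eq, Subtype.exists, id]
      exact ⟨fun hx => ⟨x, hx.1, hx.2, rfl⟩, by rintro ⟨_, h, hx, rfl⟩; exact ⟨h, hx⟩⟩
  have hle (g x : M) (hx : x ∈ insert g {h | r h g}) : x ∈ (Submodule.span ℤ (I g)).pureHull :=
    Submodule.pureHull_mono (Submodule.span_mono (Set.subset_biUnion_of_mem (u := fun x =>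
      (supp x : Set M)) hx)) (hmem x)
  have hline (g : M) : (Submodule.span ℤ {g}).pureHull ≤ (Submodule.span ℤ (I g)).pureHull := by
    rw [← Submodule.pureHull_pureHull (Submodule.span ℤ (I g))]
    refine Submodule.pureHull_mono ?_
    rw [Submodule.span_singleton_le_iff_mem]
    exact hle g g (Set.mem_insert _ _)
  refine ⟨r, hr, fun g => Submodule.span ℤ (s \ I g), fun g => ⟨?_, ?_⟩, fun g => ?_, ?_⟩
  · have := Module.Free.of_basis (Module.Basis.span (hli g).linearIndependent)
    rwa [show (Set.range fun x : ↑(s \ I g) => id (x : M)) = s \ I g from Subtype.range_coe]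
      at this
  · rw [rank_span_set (hli g), hJ]
  · exact (hdisj g).symm.mono_right (hline g)
  · intro g h hhg hh
    obtain ⟨b, hb, a, ha, rfl⟩ := Submodule.mem_sup.1 hh
    have hb' : b ∈ (Submodule.span ℤ (I g)).pureHull := by
      have := Submodule.sub_mem _ (hle g _ (Set.mem_insert_of_mem _ hhg)) (hline g ha)
      rwa [add_sub_cancel_right] at this
    rw [Submodule.disjoint_def.1 (hdisj g) b hb' hb, zero_add]
    exact ha

/-- A nonzero `g` is selected when no earlier selected `H h` contains it, and it is then private to
`H g`. Indeed, if a later selected `H h` contained `g`, then `g` would lie on the rank one line of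
`h`. So `h` would lie on the line of `g`, inside `H g`, and would not have been selected. -/
theorem exists_essential_cover [Infinite M] (hrank : Module.rank ℤ M = Cardinal.mk M) :
    ∃ C : Set (Submodule ℤ M), (∀ x, ∃ H ∈ C, x ∈ H) ∧
      (∀ H ∈ C, ∃ x ∈ H, ∀ H' ∈ C, x ∈ H' → H' = H) ∧
      ∀ H ∈ C, ∃ P Q : Submodule ℤ M, P ⊔ Q = H ∧ Disjoint P Q ∧ Module.Free ℤ P ∧
        Module.rank ℤ P = Cardinal.mk M := by
  obtain ⟨r, hr, B, hB, hdisj, hlt⟩ := exists_family_sup_pureHull hrank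
  let H (g : M) : Submodule ℤ M := B g ⊔ (Submodule.span ℤ {g}).pureHull
  have hself (g : M) : g ∈ H g := Submodule.mem_sup_right
    (Submodule.le_pureHull _ (Submodule.mem_span_singleton_self g))
  obtain ⟨S, hS⟩ := exists_selection_of_wellFounded hr.wf (· ≠ 0) (fun h g => g ∉ H h)
  have hcov (g : M) (hg : g ≠ 0) : ∃ h, S h ∧ g ∈ H h := by
    by_cases hSg : S g
    · exact ⟨g, hSg, hself g⟩
    · rw [hS] at hSg
      push Not at hSg
      obtain ⟨h, -, hSh, hgh⟩ := hSg hg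
      exact ⟨h, hSh, hgh⟩
  have hpriv (g h : M) (hSg : S g) (hSh : S h) (hgh : g ∈ H h) : h = g := by
    rcases trichotomous_of r h g with hlt' | rfl | hgt
    · exact absurd hgh (((hS g).1 hSg).2 h hlt' hSh)
    · rfl
    · refine absurd ?_ (((hS h).1 hSh).2 g hgt hSg)
      exact Submodule.mem_sup_right
        (mem_pureHull_span_singleton_symm ((hS g).1 hSg).1 (hlt h g hgt hgh))
  refine ⟨H '' {g | S g}, fun x => ?_, ?_, ?_⟩
  · by_cases hx : x = 0
    · obtain ⟨y, hy⟩ := exists_ne (0 : M)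
      obtain ⟨h, hSh, -⟩ := hcov y hy
      exact ⟨H h, ⟨h, hSh, rfl⟩, hx ▸ Submodule.zero_mem _⟩
    · obtain ⟨h, hSh, hxh⟩ := hcov x hx
      exact ⟨H h, ⟨h, hSh, rfl⟩, hxh⟩
  · rintro _ ⟨g, hSg, rfl⟩
    refine ⟨g, hself g, ?_⟩
    rintro _ ⟨h, hSh, rfl⟩ hgh
    rw [hpriv g h hSg hSh hgh]
  · rintro _ ⟨g, hSg, rfl⟩
    exact ⟨B g, _, rfl, hdisj g, (hB g).1, (hB g).2⟩

/-- Multiplication by the index `n` carries `M` into `P ⊔ Q`. Projecting to `P` gives a map that is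
multiplication by `n` on `P`, and some coordinate of it is nonzero. -/
theorem exists_linearMap_int_ne_zero_of_finiteIndex {P Q : Submodule ℤ M} (hPQ : Disjoint P Q)
    (hP : Module.Free ℤ P) (hP0 : P ≠ ⊥) (hfin : (P ⊔ Q).toAddSubgroup.FiniteIndex) :
    ∃ f : M →ₗ[ℤ] ℤ, f ≠ 0 := by
  set n := (P ⊔ Q).toAddSubgroup.index with hn
  have hn0 : n ≠ 0 := hfin.index_ne_zero
  let φ : P →ₗ[ℤ] M ⧸ Q := Q.mkQ ∘ₗ P.subtype
  have hφ : Function.Injective φ := by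
    rw [← LinearMap.ker_eq_bot, LinearMap.ker_eq_bot']
    intro x hx
    exact Subtype.ext (Submodule.disjoint_def.1 hPQ x x.2 ((Submodule.Quotient.mk_eq_zero _).1 hx))
  have hrange (m : M) : (n • Q.mkQ) m ∈ LinearMap.range φ := by
    have : n • m ∈ P ⊔ Q := AddSubgroup.nsmul_index_mem (P ⊔ Q).toAddSubgroup m
    obtain ⟨p, hp, q, hq, hpq⟩ := Submodule.mem_sup.1 this
    refine ⟨⟨p, hp⟩, ?_⟩
    rw [LinearMap.smul_apply, ← map_nsmul, ← hpq]
    simpa [φ, Submodule.Quotient.mk_eq_zero] using hq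
  let f : M →ₗ[ℤ] P := (LinearEquiv.ofInjective φ hφ).symm ∘ₗ (n • Q.mkQ).codRestrict _ hrange
  have hf (p : P) : f p = n • p := by
    rw [LinearMap.comp_apply, LinearEquiv.coe_coe, LinearEquiv.symm_apply_eq]
    exact Subtype.ext (by simp [φ])
  obtain ⟨p, hpP, hp0⟩ := P.ne_bot_iff.1 hP0
  have hnp : n • (⟨p, hpP⟩ : P) ≠ 0 := smul_ne_zero hn0 (by simpa using hp0)
  let b := Module.Free.chooseBasis ℤ P
  obtain ⟨i, hi⟩ : ∃ i, b.coord i (n • (⟨p, hpP⟩ : P)) ≠ 0 := by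
    by_contra! h
    exact hnp (b.forall_coord_eq_zero_iff.1 h)
  exact ⟨b.coord i ∘ₗ f, fun h => hi (by rw [← hf]; exact LinearMap.congr_fun h p)⟩

end EssentialUnion

theorem hasSummandIsomorphicTo_of_sup_eq {G A : Type*} [CommGroup G] [CommGroup A]
    {P Q H : Subgroup G} (hH : P ⊔ Q = H) (hPQ : Disjoint P Q) (e : P ≃* A) :
    HasSummandIsomorphicTo H A := by
  subst hH
  refine ⟨P.subgroupOf (P ⊔ Q), Q.subgroupOf (P ⊔ Q), ⟨?_, Subgroup.codisjoint_subgroupOf_sup P Q⟩,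
    ⟨(Subgroup.subgroupOfEquivOfLe le_sup_left).trans e⟩⟩
  rw [Subgroup.disjoint_def] at hPQ ⊢
  exact fun {x} hx hx' => Subtype.ext (hPQ hx hx')

theorem exists_essentialUnion_of_rank_eq {G A : Type u} [CommGroup G] [CommGroup A]
    [IsMulTorsionFree G] [Infinite G] (hG : ∀ f : Additive G →ₗ[ℤ] ℤ, f = 0)
    (hA : IsFreeAbelian A) (hrG : Module.rank ℤ (Additive G) = Cardinal.mk G)
    (hrA : Module.rank ℤ (Additive A) = Cardinal.mk G) :
    ∃ C : Set (Subgroup G), C.Infinite ∧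
      IsEssentialUnion Set.univ ((fun H : Subgroup G => (H : Set G)) '' C) ∧
      ∀ H ∈ C, HasSummandIsomorphicTo H A := by
  have : Infinite (Additive G) := ‹Infinite G›
  obtain ⟨C, hcov, hpriv, hsum⟩ := exists_essential_cover (M := Additive G) hrG
  let e : Submodule ℤ (Additive G) ≃o Subgroup G :=
    (Subgroup.toAddSubgroup.trans AddSubgroup.toIntSubmodule).symm
  refine ⟨e '' C, ?_, ⟨?_, ?_⟩, ?_⟩
  · intro hfin
    have hfin := (Set.finite_image_iff e.injective.injOn).1 hfin
    -- B. H. Neumann's lemma: in a finite cover by subgroups, some member has finite index.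
    obtain ⟨H, hH, hidx⟩ := Submodule.exists_finiteIndex_of_cover (p := id) (s := hfin.toFinset)
      (Set.eq_univ_of_forall fun x => by simpa using hcov x)
    obtain ⟨P, Q, rfl, hPQ, hfree, hrank⟩ := hsum H (by simpa using hH)
    obtain ⟨f, hf⟩ := exists_linearMap_int_ne_zero_of_finiteIndex hPQ hfree (by
      rintro rfl
      simp at hrank
      exact Cardinal.mk_ne_zero _ hrank.symm) hidx
    exact hf (hG f)
  · refine Set.eq_univ_of_forall fun x => ?_
    obtain ⟨H, hH, hx⟩ := hcov (Additive.ofMul x)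
    exact ⟨_, ⟨_, ⟨H, hH, rfl⟩, rfl⟩, hx⟩
  · rintro _ ⟨_, ⟨H, hH, rfl⟩, rfl⟩ hU
    obtain ⟨x, hx, hxH⟩ := hpriv H hH
    obtain ⟨_, ⟨⟨_, ⟨H', hH', rfl⟩, rfl⟩, hne⟩, hxH'⟩ :=
      (hU ▸ Set.mem_univ (Additive.toMul x) : Additive.toMul x ∈ Set.sUnion _)
    exact hne (by rw [hxH H' hH' hxH']; rfl)
  · rintro _ ⟨H, hH, rfl⟩
    obtain ⟨P, Q, hsup, hPQ, hfree, hrank⟩ := hsum H hH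
    have := hA
    unfold IsFreeAbelian at this
    obtain ⟨f⟩ := nonempty_linearEquiv_of_rank_eq (hrank.trans hrA.symm)
    refine hasSummandIsomorphicTo_of_sup_eq (P := e P) (Q := e Q) (by rw [← hsup, map_sup])
      (hPQ.map_orderIso e) ?_
    exact { toFun := fun x => Additive.toMul (f ⟨Additive.ofMul x.1, x.2⟩)
            invFun := fun a => ⟨Additive.toMul (f.symm (Additive.ofMul a)).1, (f.symm _).2⟩
            left_inv := fun x => by simp
            right_inv := fun a => by simp
            map_mul' := fun x y => map_add f ⟨Additive.ofMul x.1, x.2⟩ ⟨Additive.ofMul y.1, y.2⟩ }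

/-! ### Ranks, cardinalities and the main theorem. -/

theorem rank_units_intermediateField_le {k F : Type*} [Field k] [Field F] [Algebra k F]
    (L : IntermediateField k F) :
    Module.rank ℤ (Additive (L : Type _)ˣ) ≤ Module.rank ℤ (Additive Fˣ) := by
  let φ : (L : Type _)ˣ →* Fˣ := Units.map (algebraMap L F : L →* F)
  exact LinearMap.rank_le_of_injective (MonoidHom.toAdditive φ).toIntLinearMap
    (Units.map_injective (algebraMap L F).injective)

theorem mk_eq_rank_of_isFreeAbelian {G : Type u} [CommGroup G] (h : IsFreeAbelian G)
    (hr : HasInfiniteRank G) : Cardinal.mk G = Module.rank ℤ (Additive G) := by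
  have : Module.Free ℤ (Additive G) := h
  let b := Module.Free.chooseBasis ℤ (Additive G)
  rw [HasInfiniteRank, ← b.mk_eq_rank''] at hr
  have := Cardinal.infinite_iff.2 hr
  rw [← b.mk_eq_rank'']
  have h1 := Cardinal.mk_finsupp_lift_of_infinite (Module.Free.ChooseBasisIndex ℤ (Additive G)) ℤ
  have h2 : Cardinal.mk (Additive G) = _ := Cardinal.mk_congr b.repr.toEquiv
  change Cardinal.mk (Additive G) = _
  rw [h2, h1]
  simp

theorem Cardinal.mk_units_of_infinite (K : Type u) [Field K] [Infinite K] :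
    Cardinal.mk Kˣ = Cardinal.mk K := by
  rw [Cardinal.mk_congr unitsEquivNeZero]
  exact Cardinal.mk_compl_of_infinite {(0 : K)}
    (by simpa using Cardinal.one_lt_aleph0.trans_le (Cardinal.aleph0_le_mk K))

theorem bot_ne_top_of_ne_bot {k F : Type*} [Field k] [Field F] [Algebra k F]
    {L : IntermediateField k F} (hL : L ≠ ⊥) : (⊥ : IntermediateField k L) ≠ ⊤ := by
  intro h
  apply hL
  have := congrArg IntermediateField.lift h
  rwa [IntermediateField.lift_bot, IntermediateField.lift_top, eq_comm] at this

theorem isPurelyTranscendentalExtension_adjoin {k F : Type*} [Field k] [Field F] [Algebra k F]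
    {s : Set F} (hs : AlgebraicIndependent k ((↑) : s → F)) :
    IsPurelyTranscendentalExtension k (IntermediateField.adjoin k s) := by
  let y : s → IntermediateField.adjoin k s := fun i => ⟨i, IntermediateField.subset_adjoin k s i.2⟩
  have hy : AlgebraicIndependent k y :=
    AlgebraicIndependent.of_comp (IntermediateField.adjoin k s).val hs
  refine ⟨Set.range y, hy.coe_range, ?_⟩
  apply IntermediateField.lift_injective
  rw [IntermediateField.lift_top, IntermediateField.lift_adjoin]
  congr 1
  ext x
  simp only [Set.mem_image, Set.mem_range, exists_exists_eq_and]
  exact ⟨by rintro ⟨i, rfl⟩; exact i.2, fun hx => ⟨⟨x, hx⟩, rfl⟩⟩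

theorem exists_isProperPurelyTranscendentalBase {k F : Type*} [Field k] [Finite k] [Field F]
    [Infinite F] [Algebra k F] [IsMulTorsionFree Fˣ] :
    ∃ L : IntermediateField k F, IsProperPurelyTranscendentalBase L := by
  obtain ⟨s, hs⟩ := exists_isTranscendenceBasis k F
  have halg := hs.isAlgebraic_field
  rw [Subtype.range_coe] at halg
  refine ⟨IntermediateField.adjoin k s, fun hbot => ?_,
    isPurelyTranscendentalExtension_adjoin hs.1, halg⟩
  rw [hbot] at halg
  have : Algebra.IsAlgebraic k F :=
    Algebra.IsAlgebraic.trans k (⊥ : IntermediateField k F) F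
  have hfin : (Set.univ : Set F) ⊆ {0, 1} := fun x _ => by
    rcases eq_or_ne x 0 with rfl | hx
    · simp
    · simp [eq_one_of_isAlgebraic_of_isMulTorsionFree_units
        (Algebra.IsAlgebraic.isAlgebraic (R := k) x) hx]
  exact Set.infinite_univ ((Set.toFinite {0, 1}).subset hfin)

theorem linearMap_int_eq_zero_of_isIndecomposableGroup {G : Type*} [CommGroup G]
    (hG : IsIndecomposableGroup G) (hr : HasInfiniteRank G) (f : Additive G →ₗ[ℤ] ℤ) : f = 0 := by
  by_contra hf
  exact ((rank_le_one_of_linearMap_int_ne_zero hG.eq_bot_of_isCompl f hf).trans_lt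
    Cardinal.one_lt_aleph0).not_ge hr

theorem isReducedGroup_of_isIndecomposableGroup {G : Type*} [CommGroup G]
    (hG : IsIndecomposableGroup G) (hr : HasInfiniteRank G) : IsReducedGroup G := by
  intro D hD
  let e : Subgroup G ≃o Submodule ℤ (Additive G) :=
    Subgroup.toAddSubgroup.trans AddSubgroup.toIntSubmodule
  by_contra hD0
  exact ((rank_le_one_of_divisible hG.eq_bot_of_isCompl (e D) hD
    (fun h => hD0 ((map_eq_bot_iff e).1 h))).trans_lt Cardinal.one_lt_aleph0).not_ge hr

/-- On `Kˣ` the norm is the power map with exponent `[F : K]`, so its composite with a coordinate of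
`Kˣ` would be a nonzero map from `Fˣ` to ℤ. -/
theorem not_finiteDimensional_of_isFreeAbelian_units {K F : Type*} [Field K] [Field F] [Algebra K F]
    (hK : IsFreeAbelian Kˣ) [Nontrivial Kˣ] (hF : ∀ f : Additive Fˣ →ₗ[ℤ] ℤ, f = 0) :
    ¬ FiniteDimensional K F := by
  intro _
  have : Module.Free ℤ (Additive Kˣ) := hK
  let b := Module.Free.chooseBasis ℤ (Additive Kˣ)
  obtain ⟨x, hx⟩ := exists_ne (0 : Additive Kˣ)
  obtain ⟨i, hi⟩ : ∃ i, b.coord i x ≠ 0 := by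
    by_contra! h
    exact hx (b.forall_coord_eq_zero_iff.1 h)
  let N : Additive Fˣ →ₗ[ℤ] Additive Kˣ :=
    (MonoidHom.toAdditive (Units.map (Algebra.norm K (S := F)))).toIntLinearMap
  let y : Additive Fˣ := Additive.ofMul (Units.map (algebraMap K F : K →* F) x.toMul)
  have hN : N y = Module.finrank K F • x := by
    apply Additive.toMul.injective
    ext
    exact Algebra.norm_algebraMap (S := F) (x.toMul : K)
  have h0 := LinearMap.congr_fun (hF (b.coord i ∘ₗ N)) y
  rw [LinearMap.comp_apply, hN, map_nsmul, LinearMap.zero_apply] at h0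
  exact smul_ne_zero Module.finrank_pos.ne' hi h0

theorem mainTheorem3 (F : Type*) [Field F] [Infinite F] (hF : IsIndecomposableGroup Fˣ) :
    CharP F 2 ∧
    ∃ _ : Algebra (ZMod 2) F,
      (∃ L : IntermediateField (ZMod 2) F, IsProperPurelyTranscendentalBase L) ∧
      (IsCompletelyTranscendentalExtension (ZMod 2) F ∧ ¬ IsAlgClosed F) ∧
      (IsMulTorsionFree Fˣ ∧ IsIndecomposableGroup Fˣ ∧ HasInfiniteRank Fˣ ∧
        IsReducedGroup Fˣ ∧ ∀ f : Additive Fˣ →+ ℤ, f = 0) ∧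
      ∀ L : IntermediateField (ZMod 2) F, IsProperPurelyTranscendentalBase L →
        (IsFreeAbelian (L : Type _)ˣ ∧ HasInfiniteRank (L : Type _)ˣ) ∧
        ¬ FiniteDimensional L F ∧
        ∃ C : Set (Subgroup Fˣ), C.Infinite ∧
          IsEssentialUnion Set.univ ((fun H : Subgroup Fˣ => (H : Set Fˣ)) '' C) ∧
          ∀ H ∈ C, HasSummandIsomorphicTo H (L : Type _)ˣ := by
  have htf := isMulTorsionFree_units_of_isIndecomposableGroup hF
  have hchar := charP_two_of_isMulTorsionFree_units (F := F)
  let _ : Algebra (ZMod 2) F := ZMod.algebra F 2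
  have hbase : ∃ L : IntermediateField (ZMod 2) F, IsProperPurelyTranscendentalBase L :=
    exists_isProperPurelyTranscendentalBase
  have hfree (L : IntermediateField (ZMod 2) F) (hL : IsProperPurelyTranscendentalBase L) :
      IsFreeAbelian (L : Type _)ˣ ∧ HasInfiniteRank (L : Type _)ˣ :=
    hL.2.1.isFreeAbelian_units (bot_ne_top_of_ne_bot hL.1)
  have hrank : HasInfiniteRank Fˣ := by
    obtain ⟨L, hL⟩ := hbase
    exact (hfree L hL).2.trans (rank_units_intermediateField_le L)
  have hhom := linearMap_int_eq_zero_of_isIndecomposableGroup hF hrank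
  refine ⟨hchar, inferInstance, hbase,
    ⟨isCompletelyTranscendentalExtension_of_isMulTorsionFree_units,
      not_isAlgClosed_of_isMulTorsionFree_units⟩,
    ⟨htf, hF, hrank, isReducedGroup_of_isIndecomposableGroup hF hrank, fun f => ?_⟩,
    fun L hL => ⟨hfree L hL, ?_, ?_⟩⟩
  · ext x
    exact LinearMap.congr_fun (hhom f.toIntLinearMap) x
  all_goals
    obtain ⟨hLfree, hLrank⟩ := hfree L hL
    have hcard := mk_eq_rank_of_isFreeAbelian hLfree hLrank
    have : Infinite (L : Type _)ˣ := Cardinal.infinite_iff.2 (hcard ▸ hLrank)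
  · exact not_finiteDimensional_of_isFreeAbelian_units hLfree hhom
  -- The chain `|Fˣ| = |F| ≤ |L| = |Lˣ| = rank Lˣ ≤ rank Fˣ ≤ |Fˣ|` collapses to equalities.
  · have : Infinite L := Infinite.of_injective (Units.val : (L : Type _)ˣ → L) Units.val_injective
    have halg := hL.2.2
    have h1 : Cardinal.mk Fˣ = Cardinal.mk F := Cardinal.mk_units_of_infinite F
    have h2 : Cardinal.mk F ≤ Cardinal.mk L := by
      simpa using Algebra.IsAlgebraic.cardinalMk_le_max L F
    have h3 : Cardinal.mk (L : Type _)ˣ = Cardinal.mk L := Cardinal.mk_units_of_infinite L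
    have h4 := rank_units_intermediateField_le L
    have h5 : Module.rank ℤ (Additive Fˣ) ≤ Cardinal.mk Fˣ := rank_le_card ℤ (Additive Fˣ)
    have h6 : Cardinal.mk Fˣ ≤ Module.rank ℤ (Additive (L : Type _)ˣ) := by
      rw [h1, ← hcard, h3]
      exact h2
    have : Infinite Fˣ := Cardinal.infinite_iff.2 (h1 ▸ Cardinal.aleph0_le_mk F)
    exact exists_essentialUnion_of_rank_eq hhom hLfree (h5.antisymm (h6.trans h4))
      ((h4.trans h5).antisymm h6)
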